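/- Let $k\ge 2$ be an integer and let $G$ be the finite graph obtained from a cycle $v_0v_1\cdots v_{2k-1}$ on $2k$ vertices by attaching one or more pendent vertices to each of the alternate vertices $v_0,v_2,\dots,v_{2k-2}$ (and none to the other cycle vertices). Then $G$ is a cactus, i.e. a connected graph in which any two distinct simple cycles have at most one vertex in common. Let $X$ be the set of cut vertices of $G$, and let $\operatorname{mvc}_X(G)$ be the minimum cardinality of a vertex cover of $G$ that contains $X$. The eternal vertex cover number $\operatorname{evc}(G)$ is the minimum number of guards with which a defender can win the following game. The defender first places the guards on vertices of $G$. In each round an attacker attacks an edge, and the defender responds by moving the guards in parallel, each guard staying where it is or moving to a neighbouring vertex, so that at least one guard moves along the attacked edge from one endpoint to the other. The defender wins if every attack of any infinite sequence can be answered in this way. There are two versions of the game: in one, several guards may share a vertex; in the other, no configuration may have more than one guard on a vertex. Then $G$ has a minimum vertex cover of size $k$ that contains all cut vertices of $G$, so that $\operatorname{mvc}_X(G)=k$, and, in both versions of the game, $$\operatorname{evc}(G)=k+\left\lceil\frac{k+1}{2}\right\rceil .$$ Consequently $\operatorname{evc}(G)>1.5\,\operatorname{mvc}_X(G)$. -/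

import Mathlib

/-- `x` is a cut vertex of `G`: two vertices that are connected in `G` get disconnected
when `x` is deleted (that is, deleting `x` increases the number of components). -/
def IsCutVertex {V : Type*} (G : SimpleGraph V) (x : V) : Prop :=
  ∃ (u v : V) (hu : u ∈ ({x}ᶜ : Set V)) (hv : v ∈ ({x}ᶜ : Set V)),
    G.Reachable u v ∧ ¬ (G.induce ({x}ᶜ : Set V)).Reachable ⟨u, hu⟩ ⟨v, hv⟩

/-- The set `X` of all cut vertices of `G`. -/
def cutVertices {V : Type*} (G : SimpleGraph V) : Set V := {x | IsCutVertex G x}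

/-- A cactus: a connected graph in which any two distinct simple cycles have at most one
vertex in common. Two cycles are the same when they are the same subgraph. -/
def IsCactus {V : Type*} (G : SimpleGraph V) : Prop :=
  G.Connected ∧
    ∀ (u v : V) (c : G.Walk u u) (d : G.Walk v v), c.IsCycle → d.IsCycle →
      c.toSubgraph ≠ d.toSubgraph → (c.toSubgraph.verts ∩ d.toSubgraph.verts).Subsingleton

/-- `mvc_S(G)`: the minimum cardinality of a vertex cover of `G` that contains all of `S`. -/
noncomputable def mvcContaining {V : Type*} (G : SimpleGraph V) (S : Set V) : ℕ :=
  sInf {n | ∃ C : Finset V, G.IsVertexCover (C : Set V) ∧ S ⊆ (C : Set V) ∧ C.card = n}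

/-- `mvc_X(G)`, where `X` is the set of cut vertices of `G`. -/
noncomputable def mvcX {V : Type*} (G : SimpleGraph V) : ℕ :=
  mvcContaining G (cutVertices G)

/-- One round of the game with `n` guards, `c i` and `c' i` being the positions of guard `i`
before and after the round: every guard stays or moves to a neighbouring vertex, and some
guard moves along the attacked edge `e`, from one of its endpoints to the other. -/
def DefendsAttack {V : Type*} (G : SimpleGraph V) {n : ℕ} (c c' : Fin n → V)
    (e : G.edgeSet) : Prop :=
  (∀ i, c' i = c i ∨ G.Adj (c i) (c' i)) ∧ ∃ i, s(c i, c' i) = (e : Sym2 V)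

/-- A defense strategy with `n` guards: to each finite history of attacks (latest attack first)
it assigns the configuration after these attacks, `σ []` being the initial configuration, such
that every further attack is successfully defended. Several guards may share a vertex. -/
def IsDefenseStrategy {V : Type*} (G : SimpleGraph V) {n : ℕ}
    (σ : List G.edgeSet → Fin n → V) : Prop :=
  ∀ (h : List G.edgeSet) (e : G.edgeSet), DefendsAttack G (σ h) (σ (e :: h)) e

/-- The eternal vertex cover number: the least number of guards with a defense strategy. -/
noncomputable def evc {V : Type*} (G : SimpleGraph V) : ℕ :=
  sInf {n | ∃ σ : List G.edgeSet → Fin n → V, IsDefenseStrategy G σ}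

/-- The eternal vertex cover number in the version of the game in which no configuration
may have more than one guard on a vertex. -/
noncomputable def evcSingle {V : Type*} (G : SimpleGraph V) : ℕ :=
  sInf {n | ∃ σ : List G.edgeSet → Fin n → V,
    IsDefenseStrategy G σ ∧ ∀ h, Function.Injective (σ h)}

/-- The cycle on `n` vertices (for `3 ≤ n`) together with a pendent vertex for each `p : P`,
adjacent only to the cycle vertex `f p`. -/
def cycleWithPendents (n : ℕ) {P : Type*} (f : P → Fin n) : SimpleGraph (Fin n ⊕ P) where
  Adj
    | .inl a, .inl b => (SimpleGraph.cycleGraph n).Adj a b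
    | .inl a, .inr p => f p = a
    | .inr p, .inl a => f p = a
    | .inr _, .inr _ => False
  symm := ⟨by
    rintro (a | p) (b | q) h
    · exact SimpleGraph.Adj.symm h
    · exact h
    · exact h
    · exact h⟩
  loopless := ⟨by
    rintro (a | p) h
    · exact SimpleGraph.irrefl _ h
    · exact h⟩

/-! Call the alternate vertices even. Both bounds express that each even vertex needs a guard and a
half, and that exactly `3k/2` guards do not suffice.

Lower bound: a guard counts 2 for an even vertex `x` if it is on `x` or a pendent of `x`, and 1 if
it is on a cycle neighbour of `x`, so it counts at most 2 in total. A defensible configuration has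
weight at least 3 at each even vertex (`three_le_sum_guardWeight`), and at least 4 where a pendent
is guarded (`four_le_sum_guardWeight`). Attacking a pendent edge forces a guarded pendent, whence `3
* k < 2 * n`.

Upper bound: with `3 * k < 2 * n` guards, robust covers are preserved. An attack between two guarded
vertices is answered by a swap. Otherwise the guard on an even `j` moves to the free `y`, and the
gap is refilled from behind by shifting guards along an arc of the cycle (`exists_shift`). The arc
stops at an even vertex that can take in a guard without harm: one with a guarded pendent, or one
preceded by an even vertex with both cycle neighbours guarded. Counting supplies such a vertex
(`exists_surplus`). All moves are injective on the occupied set, so one strategy serves both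
versions of the game. -/

/-! ### Robust covers and shifting guards along an arc -/

/-- Guard configurations from which every attack can be answered: with `E` singling out the
alternate vertices of the cycle and `d` a step along it, all vertices in `E` are guarded, each
has at most one guarded pendent vertex, and each has some further guarded neighbour. -/
structure IsRobustCover {Z P : Type*} [AddCommGroup Z] (f : P → Z) (E : Z → Prop) (d : Z)
    (S : Set (Z ⊕ P)) : Prop where
  inl_mem : ∀ a, E a → Sum.inl a ∈ S
  pendent_unique : ∀ p p', Sum.inr p ∈ S → Sum.inr p' ∈ S → f p = f p' → p = p'
  covered : ∀ a, E a →
    Sum.inl (a - d) ∈ S ∨ Sum.inl (a + d) ∈ S ∨ ∃ p, f p = a ∧ Sum.inr p ∈ S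

open Classical in
/-- Shifting the guards along an arc `A` of alternate vertices that ends in `j`, where the guard
on `j` moves to the free vertex `y`. -/
theorem IsRobustCover.exists_shift {Z P : Type*} [AddCommGroup Z] {f : P → Z} {E : Z → Prop}
    {d : Z} {S : Set (Z ⊕ P)} (hS : IsRobustCover f E d S) (G : SimpleGraph (Z ⊕ P))
    (hadj : ∀ a, G.Adj (Sum.inl a) (Sum.inl (a + d)))
    (hp : ∀ p, G.Adj (Sum.inl (f p)) (Sum.inr p))
    (hE : ∀ a, E (a + d) ↔ ¬ E a) (hfE : ∀ p, E (f p))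
    {j : Z} (hj : E j) {y : Z ⊕ P} (hy : y ∉ S)
    (hyj : y = Sum.inl (j + d) ∨ ∃ q, f q = j ∧ y = Sum.inr q)
    (hin : Sum.inl (j - d) ∈ S ∨ ∃ p, f p = j ∧ Sum.inr p ∈ S)
    {A : Set Z} (hAj : j ∈ A) (hAE : ∀ x ∈ A, E x)
    (hnext : ∀ x ∈ A, x ≠ j → x + d + d ∈ A ∧ ∀ p, f p = x + d + d → Sum.inr p ∉ S)
    (hlast : ∀ x, x ∉ A → x + d + d ∈ A →
      (∃ p, f p = x + d + d ∧ Sum.inr p ∈ S) ∨ Sum.inl (x - d) ∈ S)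
    (hprev : ∀ x ∈ A, Sum.inl (x - d) ∉ S → (∀ p, f p = x → Sum.inr p ∉ S) →
      x - d - d ∈ A ∧ x - d - d ≠ j) :
    ∃ g : Z ⊕ P → Z ⊕ P, Set.InjOn g S ∧ (∀ v ∈ S, g v = v ∨ G.Adj v (g v)) ∧
      g (Sum.inl j) = y ∧ IsRobustCover f E d (g '' S) := by
  set pend : Z → Prop := fun x => ∃ p, f p = x ∧ Sum.inr p ∈ S with hpend
  set inp : Z → Prop := fun x => Sum.inl (x - d) ∈ S ∨ pend x with hinp
  have hyadj : G.Adj (Sum.inl j) y := by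
    rcases hyj with rfl | ⟨q, rfl, rfl⟩
    · exact hadj _
    · exact hp _
  -- An even vertex `x` of the arc releases its guard forward only if `inp x`, that is, if a
  -- replacement can come from a pendent or from `x - d`. A guarded pendent has priority; the guard
  -- on `x - d` steps in only without one.
  let g : Z ⊕ P → Z ⊕ P := Sum.elim
    (fun x => if E x then
        (if x ∈ A ∧ inp x then (if x = j then y else Sum.inl (x + d)) else Sum.inl x)
      else (if x + d ∈ A ∧ ¬ pend (x + d) then Sum.inl (x + d) else Sum.inl x))
    (fun p => if f p ∈ A then Sum.inl (f p) else Sum.inr p)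
  have g_j : g (Sum.inl j) = y := by simp [g, hj, hAj, hinp, hpend, hin]
  have g_act : ∀ x, x ∈ A → inp x → x ≠ j → g (Sum.inl x) = Sum.inl (x + d) := by
    intro x hx hi hxj; simp only [g, Sum.elim_inl]
    rw [if_pos (hAE x hx), if_pos ⟨hx, hi⟩, if_neg hxj]
  have g_stay : ∀ x, E x → ¬ (x ∈ A ∧ inp x) → g (Sum.inl x) = Sum.inl x := by
    intro x hx h; simp only [g, Sum.elim_inl]; rw [if_pos hx, if_neg h]
  have g_odd : ∀ x, ¬ E x → (x + d ∈ A ∧ ¬ pend (x + d)) → g (Sum.inl x) = Sum.inl (x + d) := by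
    intro x hx h; simp only [g, Sum.elim_inl]; rw [if_neg hx, if_pos h]
  have g_odd' : ∀ x, ¬ E x → ¬ (x + d ∈ A ∧ ¬ pend (x + d)) → g (Sum.inl x) = Sum.inl x := by
    intro x hx h; simp only [g, Sum.elim_inl]; rw [if_neg hx, if_neg h]
  have g_p : ∀ p, f p ∈ A → g (Sum.inr p) = Sum.inl (f p) := by
    intro p h; simp only [g, Sum.elim_inr]; rw [if_pos h]
  have g_p' : ∀ p, f p ∉ A → g (Sum.inr p) = Sum.inr p := by
    intro p h; simp only [g, Sum.elim_inr]; rw [if_neg h]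
  have hE' : ∀ a, E (a - d) ↔ ¬ E a := by
    intro a
    have := hE (a - d)
    rw [sub_add_cancel] at this
    tauto
  clear_value g
  -- the guards that end up on a given vertex
  have key : ∀ v ∈ S,
      (v = Sum.inl j ∧ g v = y) ∨
      (∃ x, x ∈ A ∧ inp x ∧ x ≠ j ∧ v = Sum.inl x ∧ g v = Sum.inl (x + d)) ∨
      (∃ x, E x ∧ ¬ (x ∈ A ∧ inp x) ∧ v = Sum.inl x ∧ g v = Sum.inl x) ∨
      (∃ x, x ∈ A ∧ inp x ∧ ¬ pend x ∧ v = Sum.inl (x - d) ∧ g v = Sum.inl x) ∨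
      (∃ x, ¬ E x ∧ ¬ (x + d ∈ A ∧ ¬ pend (x + d)) ∧ v = Sum.inl x ∧ g v = Sum.inl x) ∨
      (∃ p, f p ∈ A ∧ v = Sum.inr p ∧ g v = Sum.inl (f p)) ∨
      (∃ p, f p ∉ A ∧ v = Sum.inr p ∧ g v = Sum.inr p) := by
    rintro (x | p) hv
    · by_cases hx : E x
      · by_cases h : x ∈ A ∧ inp x
        · by_cases hxj : x = j
          · subst hxj; exact Or.inl ⟨rfl, g_j⟩
          · exact Or.inr (Or.inl ⟨x, h.1, h.2, hxj, rfl, g_act x h.1 h.2 hxj⟩)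
        · exact Or.inr (Or.inr (Or.inl ⟨x, hx, h, rfl, g_stay x hx h⟩))
      · by_cases h : x + d ∈ A ∧ ¬ pend (x + d)
        · refine Or.inr (Or.inr (Or.inr (Or.inl ⟨x + d, h.1, ?_, h.2, ?_, g_odd x hx h⟩)))
          · left; rwa [add_sub_cancel_right]
          · rw [add_sub_cancel_right]
        · exact Or.inr (Or.inr (Or.inr (Or.inr (Or.inl ⟨x, hx, h, rfl, g_odd' x hx h⟩))))
    · by_cases h : f p ∈ A
      · exact Or.inr (Or.inr (Or.inr (Or.inr (Or.inr (Or.inl ⟨p, h, rfl, g_p p h⟩)))))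
      · exact Or.inr (Or.inr (Or.inr (Or.inr (Or.inr (Or.inr ⟨p, h, rfl, g_p' p h⟩)))))
  refine ⟨g, ?_, ?_, g_j, ?_, ?_, ?_⟩
  -- The critical collision is a guard moving from `x ≠ j` to an occupied `x + d`. By `hnext`, `x +
  -- d + d` lies in the arc and has no guarded pendent, so the guard on `x + d` moves on at the same
  -- time.
  · have hyS : ∀ v ∈ S, v ≠ y := fun v hv h => hy (h ▸ hv)
    have hyA : ∀ x ∈ A, y ≠ Sum.inl x := fun x hx h => hy (h ▸ hS.inl_mem x (hAE x hx))
    have hyd : ∀ x, x ≠ j → y ≠ Sum.inl (x + d) := by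
      rintro x hx h
      rcases hyj with h' | ⟨q, -, h'⟩ <;> rw [h'] at h
      · exact hx (by simpa using h.symm)
      · cases h
    have hpendI : ∀ p, Sum.inr p ∈ S → pend (f p) := fun p h => ⟨p, rfl, h⟩
    have hinpI : ∀ x, pend x → inp x := fun x h => Or.inr h
    have hnext' : ∀ x ∈ A, x ≠ j → x + d + d ∈ A ∧ ¬ pend (x + d + d) := fun x hx hxj =>
      ⟨(hnext x hx hxj).1, fun ⟨p, h1, h2⟩ => (hnext x hx hxj).2 p h1 h2⟩
    have huniq := hS.pendent_unique
    clear_value pend inp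
    clear hS hnext hlast hprev hin hyj hadj hp g_j g_act g_stay g_odd g_odd' g_p g_p' hpend hinp
    intro v hv w hw hvw
    rcases key v hv with ⟨h1, h⟩ | ⟨x, a1, a2, a3, h1, h⟩ | ⟨x, a1, a2, h1, h⟩ |
      ⟨x, a1, a2, a3, h1, h⟩ | ⟨x, a1, a2, h1, h⟩ | ⟨p, a1, h1, h⟩ | ⟨p, a1, h1, h⟩ <;>
    rcases key w hw with ⟨h2, h'⟩ | ⟨x', b1, b2, b3, h2, h'⟩ | ⟨x', b1, b2, h2, h'⟩ |
      ⟨x', b1, b2, b3, h2, h'⟩ | ⟨x', b1, b2, h2, h'⟩ | ⟨p', b1, h2, h'⟩ | ⟨p', b1, h2, h'⟩ <;>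
    clear key <;> rw [h, h'] at hvw <;> clear h h' <;> grind
  · intro v hv
    rcases key v hv with ⟨rfl, h⟩ | ⟨x, -, -, -, rfl, h⟩ | ⟨x, -, -, rfl, h⟩ |
      ⟨x, -, -, -, rfl, h⟩ | ⟨x, -, -, rfl, h⟩ | ⟨p, -, rfl, h⟩ | ⟨p, -, rfl, h⟩ <;> rw [h]
    · exact Or.inr hyadj
    · exact Or.inr (hadj x)
    · exact Or.inl rfl
    · right; simpa using hadj (x - d)
    · exact Or.inl rfl
    · exact Or.inr (hp p).symm
    · exact Or.inl rfl
  · intro a ha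
    by_cases h : a ∈ A ∧ inp a
    · by_cases hpa : pend a
      · obtain ⟨p, rfl, hpS⟩ := hpa
        exact ⟨_, hpS, g_p p h.1⟩
      · have h1 := h.2.resolve_right hpa
        refine ⟨_, h1, ?_⟩
        rw [g_odd _ (by rw [hE']; simpa using ha) (by simpa using ⟨h.1, hpa⟩)]
        simp
    · exact ⟨_, hS.inl_mem a ha, g_stay a ha h⟩
  · have aux : ∀ p, Sum.inr p ∈ g '' S → (y = Sum.inr p ∧ f p = j) ∨ (Sum.inr p ∈ S ∧ f p ∉ A) := by
      rintro p ⟨v, hv, hgv⟩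
      rcases key v hv with ⟨rfl, h⟩ | ⟨x, -, -, -, rfl, h⟩ | ⟨x, -, -, rfl, h⟩ |
        ⟨x, -, -, -, rfl, h⟩ | ⟨x, -, -, rfl, h⟩ | ⟨p', -, rfl, h⟩ | ⟨p', hA, rfl, h⟩ <;>
        rw [h] at hgv
      · left
        refine ⟨hgv, ?_⟩
        rcases hyj with h' | ⟨q, hq, h'⟩
        · simp [h'] at hgv
        · rw [h'] at hgv; cases hgv; exact hq
      all_goals first | (cases hgv; done) | skip
      cases hgv
      exact Or.inr ⟨hv, hA⟩
    intro p p' h h' hpp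
    rcases aux p h with ⟨h1, h2⟩ | ⟨h1, h2⟩ <;> rcases aux p' h' with ⟨h3, h4⟩ | ⟨h3, h4⟩
    · rw [h1] at h3; cases h3; rfl
    · exact absurd (by rw [← hpp, h2]; exact hAj) h4
    · exact absurd (by rw [hpp, h4]; exact hAj) h2
    · exact hS.pendent_unique p p' h1 h3 hpp
  · intro a ha
    by_cases hA : a ∈ A
    · by_cases hi : inp a
      · by_cases haj : a = j
        · subst haj
          rcases hyj with h' | ⟨q, hq, h'⟩
          · exact Or.inr (Or.inl ⟨_, hS.inl_mem _ hj, by rw [g_j, h']⟩)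
          · exact Or.inr (Or.inr ⟨q, hq, ⟨_, hS.inl_mem _ hj, by rw [g_j, h']⟩⟩)
        · exact Or.inr (Or.inl ⟨_, hS.inl_mem _ ha, g_act a hA hi haj⟩)
      -- Here `a` keeps its guard but may lose the one on `a + d`. The preceding even vertex is in
      -- the arc, and since `a - d` is free its further guard is behind it or on a pendent; so it
      -- releases its guard onto `a - d`.
      · have h1 : Sum.inl (a - d) ∉ S := fun h => hi (Or.inl h)
        have h2 : ∀ p, f p = a → Sum.inr p ∉ S := fun p h h' => hi (Or.inr ⟨p, h, h'⟩)
        obtain ⟨h3, h4⟩ := hprev a hA h1 h2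
        left
        refine ⟨_, hS.inl_mem _ (hAE _ h3), ?_⟩
        rw [g_act _ h3 ?_ h4, sub_add_cancel]
        rcases hS.covered _ (hAE _ h3) with h | h | h
        · exact Or.inl h
        · rw [sub_add_cancel] at h; exact absurd h h1
        · exact Or.inr h
    -- Outside the arc, `a` can only lose the guard on `a + d`, which happens just behind the arc's
    -- far end; `hlast` then provides a guard on `a - d`, which stays.
    · have left_ok : Sum.inl (a - d) ∈ S → Sum.inl (a - d) ∈ g '' S := fun h =>
        ⟨_, h, g_odd' _ (by rw [hE']; simpa using ha) (by simp [hA])⟩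
      rcases hS.covered a ha with h | h | ⟨p, hpa, h⟩
      · exact Or.inl (left_ok h)
      · by_cases hm : a + d + d ∈ A ∧ ¬ pend (a + d + d)
        · exact Or.inl (left_ok ((hlast a hA hm.1).resolve_left hm.2))
        · exact Or.inr (Or.inl ⟨_, h, g_odd' _ (by rw [hE]; simpa using ha) hm⟩)
      · exact Or.inr (Or.inr ⟨p, hpa, ⟨_, h, g_p' p (by rwa [hpa])⟩⟩)

/-- In a large enough robust cover some alternate vertex has a guarded pendent vertex, or is
preceded by an alternate vertex with two guarded cycle neighbours. -/
theorem IsRobustCover.exists_surplus {Z P : Type*} [AddCommGroup Z] [Finite Z] {f : P → Z}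
    {E : Z → Prop} {d : Z} {S : Set (Z ⊕ P)}
    (hE : ∀ a, E (a + d) ↔ ¬ E a) (hfE : ∀ p, E (f p)) {k : ℕ}
    (hk : {a | E a}.ncard = k) (hk' : {a | ¬ E a}.ncard = k) (hcard : 3 * k < 2 * S.ncard) :
    ∃ t, E t ∧ ((∃ p, f p = t ∧ Sum.inr p ∈ S) ∨
      (Sum.inl (t - d) ∈ S ∧ Sum.inl (t - d - d - d) ∈ S)) := by
  by_contra! hno
  have hpend : ∀ p, Sum.inr p ∉ S := fun p => (hno (f p) (hfE p)).1 p rfl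
  set U : Set Z := {a | ¬ E a ∧ Sum.inl a ∈ S} with hU
  have hE' : ∀ a, E (a - d) ↔ ¬ E a := fun a => by
    have := hE (a - d)
    rw [sub_add_cancel] at this
    tauto
  have hS : S ⊆ Sum.inl '' ({a | E a} ∪ U) := by
    rintro (a | p) h
    · by_cases ha : E a
      · exact ⟨a, Or.inl ha, rfl⟩
      · exact ⟨a, Or.inr ⟨ha, h⟩, rfl⟩
    · exact absurd h (hpend p)
  have h1 : S.ncard ≤ k + U.ncard := by
    refine (Set.ncard_le_ncard hS ((Set.toFinite _).image _)).trans
      ((Set.ncard_image_le (Set.toFinite _)).trans ?_)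
    rw [← hk]
    exact Set.ncard_union_le _ _
  -- Without surplus, no two consecutive odd vertices are both guarded, so at most half of the odd
  -- vertices are.
  have hdisj : Disjoint U ((fun a => a - d - d) '' U) := by
    rw [Set.disjoint_left]
    rintro a ha ⟨b, hb, rfl⟩
    have hb2 := (hno (b + d) ((hE b).2 hb.1)).2
    rw [add_sub_cancel_right] at hb2
    exact hb2 hb.2 ha.2
  have h2 : U.ncard + U.ncard ≤ k := by
    have hinj : Function.Injective (fun a : Z => a - d - d) := fun a b h => by simpa using h
    rw [← Set.ncard_image_of_injective U hinj]
    nth_rw 1 [Set.ncard_image_of_injective U hinj]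
    rw [← Set.ncard_union_eq hdisj (Set.toFinite _) (Set.toFinite _), ← hk']
    refine Set.ncard_le_ncard ?_ (Set.toFinite _)
    rintro a (ha | ⟨b, hb, rfl⟩)
    · exact ha.1
    · simp only [Set.mem_ofPred_eq, hE', not_not]
      exact hb.1
  omega

/-- From a large enough robust cover, the guard on an alternate vertex `j` can move to a free
neighbour `y` if `j` has a guarded neighbour that is not ahead of it. -/
theorem IsRobustCover.exists_response {Z P : Type*} [AddCommGroup Z] [Finite Z] {f : P → Z}
    {E : Z → Prop} {d : Z} {S : Set (Z ⊕ P)} (hS : IsRobustCover f E d S)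
    (G : SimpleGraph (Z ⊕ P))
    (hadj : ∀ a, G.Adj (Sum.inl a) (Sum.inl (a + d)))
    (hp : ∀ p, G.Adj (Sum.inl (f p)) (Sum.inr p))
    (hE : ∀ a, E (a + d) ↔ ¬ E a) (hfE : ∀ p, E (f p)) {k : ℕ}
    (hk : {a | E a}.ncard = k) (hk' : {a | ¬ E a}.ncard = k) (hcard : 3 * k < 2 * S.ncard)
    (hgen : ∀ i j, E i → E j → ∃ r < k, i = j - (2 * r) • d)
    (hord : ∀ r, 0 < r → r < k → (2 * r) • d ≠ 0)
    {j : Z} (hj : E j) {y : Z ⊕ P} (hy : y ∉ S)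
    (hyj : y = Sum.inl (j + d) ∨ ∃ q, f q = j ∧ y = Sum.inr q)
    (hin : Sum.inl (j - d) ∈ S ∨ ∃ p, f p = j ∧ Sum.inr p ∈ S) :
    ∃ g : Z ⊕ P → Z ⊕ P, Set.InjOn g S ∧ (∀ v ∈ S, g v = v ∨ G.Adj v (g v)) ∧
      g (Sum.inl j) = y ∧ IsRobustCover f E d (g '' S) := by
  classical
  have hE' : ∀ a, E (a - d) ↔ ¬ E a := fun a => by
    have := hE (a - d)
    rw [sub_add_cancel] at this
    tauto
  set isLast : Z → Prop := fun t => (∃ p, f p = t ∧ Sum.inr p ∈ S) ∨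
      (Sum.inl (t - d) ∈ S ∧ Sum.inl (t - d - d - d) ∈ S) with hlast
  set pos : ℕ → Z := fun r => j - (2 * r) • d with hpos
  have pos_zero : pos 0 = j := by simp [hpos]
  have pos_succ : ∀ r, pos (r + 1) = pos r - d - d := fun r => by
    simp only [hpos, mul_add, add_nsmul, mul_one, two_nsmul]; abel
  have pos_succ' : ∀ r, pos (r + 1) + d + d = pos r := fun r => by
    rw [pos_succ]; abel
  have pos_ne : ∀ r, 0 < r → r < k → pos r ≠ j := fun r h0 hr h => by
    apply hord r h0 hr
    simpa [hpos] using h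
  have pos_E : ∀ r, E (pos r) := fun r => by
    induction r with
    | zero => rwa [pos_zero]
    | succ r ih => rw [pos_succ, hE', hE', not_not]; exact ih
  -- The arc runs backwards from `j` to the first surplus vertex. Since `r < k`, it does not return
  -- to `j`.
  have hex : ∃ r, r < k ∧ isLast (pos r) := by
    obtain ⟨t, ht, hts⟩ := exists_surplus hE hfE hk hk' hcard
    obtain ⟨r, hr, rfl⟩ := hgen t j ht hj
    exact ⟨r, hr, hts⟩
  obtain ⟨hr, hrs⟩ := Nat.find_spec hex
  have hmin : ∀ r < Nat.find hex, ¬ isLast (pos r) := fun r h h' =>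
    Nat.find_min hex h ⟨h.trans hr, h'⟩
  generalize Nat.find hex = R at hr hrs hmin
  clear_value pos
  refine hS.exists_shift G hadj hp hE hfE hj hy hyj hin (A := {x | ∃ r ≤ R, x = pos r})
    ⟨0, Nat.zero_le _, pos_zero.symm⟩ ?_ ?_ ?_ ?_
  · rintro x ⟨r, -, rfl⟩; exact pos_E r
  · rintro x ⟨r, hrR, rfl⟩ hxj
    obtain _ | r := r
    · exact absurd pos_zero hxj
    · rw [pos_succ']
      exact ⟨⟨r, by omega, rfl⟩, fun p h h' => hmin r (by omega) (Or.inl ⟨p, h, h'⟩)⟩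
  · rintro x hx ⟨r, hrR, hxr⟩
    have hxr' : x = pos (r + 1) := by rw [pos_succ, ← hxr]; abel
    have : r = R := by
      by_contra h
      exact hx ⟨r + 1, by omega, hxr'⟩
    subst this
    rcases hrs with h | h
    · left; rwa [hxr]
    · right
      have := h.2
      rw [← hxr] at this
      convert this using 2
      abel
  · rintro x ⟨r, hrR, rfl⟩ h1 h2
    have hne : r ≠ R := by
      rintro rfl
      rcases hrs with ⟨p, h, h'⟩ | h
      · exact h2 p h h'
      · exact h1 h.1
    rw [← pos_succ]
    exact ⟨⟨r + 1, by omega, rfl⟩, pos_ne _ (by omega) (by omega)⟩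

/-! ### Adjacency, parity and steps in `Fin (2 * k)` -/

theorem cycleWithPendents_adj_inl_inl {k : ℕ} [NeZero (2 * k)] (hk : 2 ≤ k) {P : Type*}
    (f : P → Fin (2 * k)) (a b : Fin (2 * k)) :
    (cycleWithPendents (2 * k) f).Adj (Sum.inl a) (Sum.inl b) ↔ b = a + 1 ∨ b = a - 1 := by
  change (SimpleGraph.cycleGraph (2 * k)).Adj a b ↔ _
  have h1 : (1 : Fin (2 * k)).val = 1 := by
    rw [Fin.val_one', Nat.mod_eq_of_lt (by omega)]
  have key : ∀ x : Fin (2 * k), x.val = 1 ↔ x = 1 := fun x => by rw [Fin.ext_iff, h1]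
  rw [SimpleGraph.cycleGraph_adj', key, key, or_comm]
  refine or_congr ?_ ?_
  · rw [sub_eq_iff_eq_add, add_comm]
  · rw [sub_eq_iff_eq_add, eq_sub_iff_add_eq, eq_comm, add_comm]

theorem Fin.even_val_add_one {k : ℕ} [NeZero (2 * k)] (a : Fin (2 * k)) :
    Even (a + 1).val ↔ ¬ Even a.val := by
  have hk := NeZero.ne (2 * k)
  rw [Fin.val_add, Fin.val_one', Nat.add_mod_mod, Nat.even_iff, Nat.even_iff,
    Nat.mod_mod_of_dvd _ (Dvd.intro _ rfl)]
  omega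

theorem Fin.even_val_sub_one {k : ℕ} [NeZero (2 * k)] (a : Fin (2 * k)) :
    Even (a - 1).val ↔ ¬ Even a.val := by
  have := Fin.even_val_add_one (a - 1)
  rw [sub_add_cancel] at this
  tauto

theorem Fin.val_nsmul_one {N : ℕ} [NeZero N] (m : ℕ) : (m • (1 : Fin N)).val = m % N := by
  induction m with
  | zero => simp
  | succ m ih => rw [succ_nsmul, Fin.val_add, ih, Fin.val_one', ← Nat.add_mod]

theorem Fin.eq_sub_nsmul_one_of_even {k : ℕ} [NeZero (2 * k)] (i j : Fin (2 * k))
    (hi : Even i.val) (hj : Even j.val) : ∃ r < k, i = j - (2 * r) • 1 := by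
  have hk := NeZero.ne (2 * k)
  have hlt := (j - i).isLt
  have hev : Even (j - i).val := by
    have hi' := i.isLt
    rw [Fin.val_sub]
    rw [Nat.even_iff] at *
    rw [Nat.mod_mod_of_dvd _ (Dvd.intro _ rfl)]
    omega
  obtain ⟨r, hr⟩ := even_iff_exists_two_mul.1 hev
  refine ⟨r, by omega, ?_⟩
  rw [eq_sub_iff_add_eq, add_comm, ← eq_sub_iff_add_eq, Fin.ext_iff, Fin.val_nsmul_one, ← hr,
    Nat.mod_eq_of_lt hlt]

theorem Fin.eq_sub_nsmul_neg_one_of_even {k : ℕ} [NeZero (2 * k)] (i j : Fin (2 * k))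
    (hi : Even i.val) (hj : Even j.val) : ∃ r < k, i = j - (2 * r) • (-1) := by
  obtain ⟨r, hr, h⟩ := Fin.eq_sub_nsmul_one_of_even j i hj hi
  refine ⟨r, hr, ?_⟩
  rw [h, smul_neg, sub_neg_eq_add, sub_add_cancel]

theorem Fin.two_mul_nsmul_one_ne_zero {k : ℕ} [NeZero (2 * k)] (r : ℕ) (h0 : 0 < r)
    (hr : r < k) : (2 * r) • (1 : Fin (2 * k)) ≠ 0 := by
  intro h
  have := congrArg Fin.val h
  rw [Fin.val_nsmul_one, Nat.mod_eq_of_lt (by omega)] at this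
  simp at this
  omega

theorem Fin.ncard_even (k : ℕ) : {a : Fin (2 * k) | Even a.val}.ncard = k := by
  have : {a : Fin (2 * k) | Even a.val} =
      Set.range (fun i : Fin k => (⟨2 * i.val, by omega⟩ : Fin (2 * k))) := by
    ext a
    simp only [Set.mem_ofPred_eq, Set.mem_range]
    constructor
    · rintro ⟨r, hr⟩
      exact ⟨⟨r, by omega⟩, Fin.ext (by simp; omega)⟩
    · rintro ⟨i, rfl⟩
      simp
  rw [this, ← Set.image_univ, Set.ncard_image_of_injective, Set.ncard_univ,
    Nat.card_eq_fintype_card, Fintype.card_fin]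
  intro i j h
  simp at h
  exact Fin.ext (by omega)

theorem Fin.ncard_not_even (k : ℕ) : {a : Fin (2 * k) | ¬ Even a.val}.ncard = k := by
  have h := Set.ncard_add_ncard_compl {a : Fin (2 * k) | Even a.val}
  rw [Fin.ncard_even, Nat.card_eq_fintype_card, Fintype.card_fin] at h
  have : {a : Fin (2 * k) | Even a.val}ᶜ = {a | ¬ Even a.val} := rfl
  rw [this] at h
  omega

/-- Reversing the orientation lets the same shift argument answer attacks in the other direction. -/
theorem IsRobustCover.neg {Z P : Type*} [AddCommGroup Z] {f : P → Z} {E : Z → Prop} {d : Z}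
    {S : Set (Z ⊕ P)} (h : IsRobustCover f E d S) : IsRobustCover f E (-d) S where
  inl_mem := h.inl_mem
  pendent_unique := h.pendent_unique
  covered a ha := by
    rw [sub_neg_eq_add, ← sub_eq_add_neg]
    have := h.covered a ha
    tauto

/-! ### Upper bound: the strategy and its initial configuration -/

section

variable {k : ℕ} [NeZero (2 * k)] {P : Type*} {f : P → Fin (2 * k)}

/-- Any attack on a robust cover of a cycle with pendent vertices can be answered by a robust
cover. -/
theorem IsRobustCover.exists_move (hk : 2 ≤ k) (hfE : ∀ p, Even (f p).val)
    {S : Set (Fin (2 * k) ⊕ P)} (hS : IsRobustCover f (fun a => Even a.val) 1 S)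
    (hcard : 3 * k < 2 * S.ncard) (e : (cycleWithPendents (2 * k) f).edgeSet) :
    ∃ g : Fin (2 * k) ⊕ P → Fin (2 * k) ⊕ P, Set.InjOn g S ∧
      (∀ v ∈ S, g v = v ∨ (cycleWithPendents (2 * k) f).Adj v (g v)) ∧
      (∃ v ∈ S, s(v, g v) = (e : Sym2 _)) ∧
      IsRobustCover f (fun a => Even a.val) 1 (g '' S) := by
  classical
  have hadj := cycleWithPendents_adj_inl_inl hk f
  have hp : ∀ p, (cycleWithPendents (2 * k) f).Adj (Sum.inl (f p)) (Sum.inr p) := fun p => rfl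
  obtain ⟨j, y, hj, hjy, he⟩ : ∃ j y, Even j.val ∧ (cycleWithPendents (2 * k) f).Adj (Sum.inl j) y ∧
      (e : Sym2 _) = s(Sum.inl j, y) := by
    obtain ⟨e, he⟩ := e
    induction e with | h u v => ?_
    rw [SimpleGraph.mem_edgeSet] at he
    rcases u with a | p <;> rcases v with b | q
    · by_cases ha : Even a.val
      · exact ⟨a, _, ha, he, rfl⟩
      · refine ⟨b, _, ?_, he.symm, Sym2.eq_swap⟩
        rcases (hadj a b).1 he with rfl | rfl
        · exact (Fin.even_val_add_one a).2 ha
        · exact (Fin.even_val_sub_one a).2 ha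
    · have h : f q = a := he
      exact ⟨a, _, h ▸ hfE q, he, rfl⟩
    · have h : f p = b := he
      exact ⟨b, _, h ▸ hfE p, he.symm, Sym2.eq_swap⟩
    · exact he.elim
  have hcov := hS.covered j hj
  have hjS : Sum.inl j ∈ S := hS.inl_mem j hj
  by_cases hy : y ∈ S
  -- Both ends are guarded: the two guards trade places and the occupied set is unchanged.
  · refine ⟨Equiv.swap (Sum.inl j) y, (Equiv.injective _).injOn, ?_, ⟨_, hjS, ?_⟩, ?_⟩
    · intro v hv
      by_cases h1 : v = Sum.inl j
      · subst h1; right; rwa [Equiv.swap_apply_left]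
      · by_cases h2 : v = y
        · subst h2; right; rw [Equiv.swap_apply_right]; exact hjy.symm
        · left; exact Equiv.swap_apply_of_ne_of_ne h1 h2
    · rw [Equiv.swap_apply_left, he]
    · have : Equiv.swap (Sum.inl j) y '' S = S := by
        ext v
        rw [Equiv.image_eq_preimage_symm, Equiv.symm_swap, Set.mem_preimage]
        by_cases h1 : v = Sum.inl j
        · subst h1; rw [Equiv.swap_apply_left]; tauto
        · by_cases h2 : v = y
          · subst h2; rw [Equiv.swap_apply_right]; tauto
          · rw [Equiv.swap_apply_of_ne_of_ne h1 h2]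
      rwa [this]
  · have fwd : (y = Sum.inl (j + 1) ∨ ∃ q, f q = j ∧ y = Sum.inr q) →
        (Sum.inl (j - 1) ∈ S ∨ ∃ p, f p = j ∧ Sum.inr p ∈ S) →
        ∃ g : Fin (2 * k) ⊕ P → Fin (2 * k) ⊕ P, Set.InjOn g S ∧
          (∀ v ∈ S, g v = v ∨ (cycleWithPendents (2 * k) f).Adj v (g v)) ∧
          (∃ v ∈ S, s(v, g v) = (e : Sym2 _)) ∧
          IsRobustCover f (fun a => Even a.val) 1 (g '' S) := by
      intro h1 h2
      obtain ⟨g, hg1, hg2, hg3, hg4⟩ := hS.exists_response (cycleWithPendents (2 * k) f)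
        (fun a => (hadj _ _).2 (Or.inl rfl)) hp Fin.even_val_add_one hfE (Fin.ncard_even k)
        (Fin.ncard_not_even k) hcard Fin.eq_sub_nsmul_one_of_even Fin.two_mul_nsmul_one_ne_zero
        hj hy h1 h2
      exact ⟨g, hg1, hg2, ⟨_, hjS, by rw [hg3, he]⟩, hg4⟩
    have bwd : (y = Sum.inl (j - 1) ∨ ∃ q, f q = j ∧ y = Sum.inr q) →
        (Sum.inl (j + 1) ∈ S ∨ ∃ p, f p = j ∧ Sum.inr p ∈ S) →
        ∃ g : Fin (2 * k) ⊕ P → Fin (2 * k) ⊕ P, Set.InjOn g S ∧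
          (∀ v ∈ S, g v = v ∨ (cycleWithPendents (2 * k) f).Adj v (g v)) ∧
          (∃ v ∈ S, s(v, g v) = (e : Sym2 _)) ∧
          IsRobustCover f (fun a => Even a.val) 1 (g '' S) := by
      intro h1 h2
      obtain ⟨g, hg1, hg2, hg3, hg4⟩ := hS.neg.exists_response (cycleWithPendents (2 * k) f)
        (fun a => (hadj _ _).2 (Or.inr (sub_eq_add_neg _ _).symm)) hp
        (fun a => by rw [← sub_eq_add_neg]; exact Fin.even_val_sub_one a) hfE (Fin.ncard_even k)
        (Fin.ncard_not_even k) hcard Fin.eq_sub_nsmul_neg_one_of_even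
        (fun r h0 hr h => Fin.two_mul_nsmul_one_ne_zero r h0 hr (by simpa using h))
        hj hy (by rwa [← sub_eq_add_neg]) (by rwa [sub_neg_eq_add])
      refine ⟨g, hg1, hg2, ⟨_, hjS, by rw [hg3, he]⟩, ?_⟩
      simpa using hg4.neg
    rcases y with b | q
    -- As `y` is free, the further guard that `covered` gives `j` is on the opposite cycle neighbour
    -- or on a pendent, as the shift requires.
    · rcases (hadj j b).1 hjy with rfl | rfl
      · exact fwd (Or.inl rfl) (by clear fwd bwd; tauto)
      · exact bwd (Or.inl rfl) (by clear fwd bwd; tauto)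
    · have hq : f q = j := hjy
      by_cases h : Sum.inl (j - 1) ∈ S ∨ ∃ p, f p = j ∧ Sum.inr p ∈ S
      · exact fwd (Or.inr ⟨q, hq, rfl⟩) h
      · exact bwd (Or.inr ⟨q, hq, rfl⟩) (by clear fwd bwd; tauto)

/-- An injective robust configuration yields a defense strategy with at most one guard on each
vertex. -/
theorem exists_injective_strategy (hk : 2 ≤ k) (hfE : ∀ p, Even (f p).val) {n : ℕ}
    (hn : 3 * k < 2 * n) (c : Fin n → Fin (2 * k) ⊕ P) (hc : Function.Injective c)
    (hcS : IsRobustCover f (fun a => Even a.val) 1 (Set.range c)) :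
    ∃ σ : List (cycleWithPendents (2 * k) f).edgeSet → Fin n → Fin (2 * k) ⊕ P,
      IsDefenseStrategy (cycleWithPendents (2 * k) f) σ ∧ ∀ h, Function.Injective (σ h) := by
  let C := {c : Fin n → Fin (2 * k) ⊕ P // Function.Injective c ∧
    IsRobustCover f (fun a => Even a.val) 1 (Set.range c)}
  have step : ∀ (c : C) (e : (cycleWithPendents (2 * k) f).edgeSet),
      ∃ c' : C, DefendsAttack (cycleWithPendents (2 * k) f) c.1 c'.1 e := by
    rintro ⟨c, hc, hcS⟩ e
    have hcard : (Set.range c).ncard = n := by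
      rw [← Set.image_univ, Set.ncard_image_of_injective _ hc, Set.ncard_univ,
        Nat.card_eq_fintype_card, Fintype.card_fin]
    obtain ⟨g, hg1, hg2, ⟨_, ⟨i, rfl⟩, hi⟩, hg4⟩ := hcS.exists_move hk hfE (by rwa [hcard]) e
    refine ⟨⟨g ∘ c, ?_, ?_⟩, fun i => hg2 _ ⟨i, rfl⟩, i, hi⟩
    · exact fun i i' h => hc (hg1 ⟨i, rfl⟩ ⟨i', rfl⟩ h)
    · rwa [Set.range_comp]
  choose next hnext using step
  -- The answer depends only on the current configuration; `foldr` fits because the latest attack is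
  -- the head.
  let τ : List (cycleWithPendents (2 * k) f).edgeSet → C := fun h =>
    h.foldr (fun e c => next c e) ⟨c, hc, hcS⟩
  exact ⟨fun h => (τ h).1, fun h e => hnext (τ h) e, fun h => (τ h).2.1⟩

theorem exists_robust_configuration (hk : 2 ≤ k) (f : P → Fin (2 * k)) :
    ∃ c : Fin (k + (k / 2 + 1)) → Fin (2 * k) ⊕ P, Function.Injective c ∧
      IsRobustCover f (fun a => Even a.val) 1 (Set.range c) := by
  -- All even vertices, then `1, 5, 9, ...`, each serving its two even neighbours. The `min` matters
  -- only for even `k`, where it puts the last guard on `2 * k - 1`.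
  let v : ℕ → ℕ := fun i => if i < k then 2 * i else 2 * min (2 * (i - k)) (k - 1) + 1
  have hv : ∀ i, v i < 2 * k := by
    intro i; simp only [v]; split_ifs <;> omega
  have val_one : (1 : Fin (2 * k)).val = 1 := by
    rw [Fin.val_one', Nat.mod_eq_of_lt (by omega)]
  have val_add : ∀ a : Fin (2 * k), Even a.val → (a + 1).val = a.val + 1 := by
    rintro a ⟨r, hr⟩
    rw [Fin.val_add, val_one, Nat.mod_eq_of_lt (by omega)]
  have mem : ∀ (a : Fin (2 * k)) (i : ℕ), i < k + (k / 2 + 1) → v i = a.val →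
      (Sum.inl a : Fin (2 * k) ⊕ P) ∈
        Set.range (fun i : Fin (k + (k / 2 + 1)) => (Sum.inl ⟨v i, hv i⟩ : Fin (2 * k) ⊕ P)) :=
    fun a i hi h => ⟨⟨i, hi⟩, by simp only [h]⟩
  refine ⟨fun i => Sum.inl ⟨v i, hv i⟩, ?_, ?_, ?_, ?_⟩
  · rintro ⟨i, hi⟩ ⟨j, hj⟩ h
    simp only [Sum.inl.injEq, Fin.mk.injEq, v] at h
    rw [Fin.mk.injEq]
    split_ifs at h <;> omega
  · rintro a ⟨r, hr⟩
    exact mem a r (by omega) (by simp only [v]; rw [if_pos (by omega)]; omega)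
  · rintro p p' ⟨i, hi⟩
    cases hi
  · rintro a ⟨r, hr⟩
    by_cases hpar : Even r
    · right; left
      obtain ⟨m, hm⟩ := hpar
      refine mem _ (k + m) (by omega) ?_
      rw [val_add a ⟨r, hr⟩]
      simp only [v]; rw [if_neg (by omega)]; omega
    · left
      obtain ⟨m, hm⟩ := Nat.not_even_iff_odd.1 hpar
      refine mem _ (k + m) (by omega) ?_
      rw [Fin.val_sub, val_one]
      have : 2 * k - 1 + a.val = (a.val - 1) + 2 * k := by omega
      rw [this, Nat.add_mod_right, Nat.mod_eq_of_lt (by omega)]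
      simp only [v]; rw [if_neg (by omega)]; omega

end

/-! ### Lower bound: weighing the guards -/

/-- Under a defense strategy the guards always form a vertex cover. -/
theorem IsDefenseStrategy.exists_guard_of_adj {V : Type*} {G : SimpleGraph V} {n : ℕ}
    {σ : List G.edgeSet → Fin n → V} (hσ : IsDefenseStrategy G σ) (h : List G.edgeSet) {u v : V}
    (huv : G.Adj u v) : ∃ i, σ h i = u ∨ σ h i = v := by
  obtain ⟨-, i, hi⟩ := hσ h ⟨s(u, v), huv⟩
  rcases Sym2.eq_iff.1 hi with ⟨h1, -⟩ | ⟨h1, -⟩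
  · exact ⟨i, Or.inl h1⟩
  · exact ⟨i, Or.inr h1⟩

section

variable {k : ℕ} [NeZero (2 * k)] {P : Type*} {f : P → Fin (2 * k)}

/-- How much a guard on `v` counts for the alternate vertex `x`: fully (`2`) on `x` or a pendent
vertex of `x`, and half (`1`) on a cycle neighbour of `x`. -/
def guardWeight (f : P → Fin (2 * k)) (x : Fin (2 * k)) : Fin (2 * k) ⊕ P → ℕ
  | .inl a => if a = x then 2 else if a = x + 1 ∨ a = x - 1 then 1 else 0
  | .inr p => if f p = x then 2 else 0

/-- An even vertex counts only for itself; an odd one splits its weight between its two neighbours.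
-/
theorem sum_guardWeight_le (f : P → Fin (2 * k)) (v : Fin (2 * k) ⊕ P) :
    ∑ x : Fin (2 * k) with Even x.val, guardWeight f x v ≤ 2 := by
  rcases v with a | p
  · by_cases ha : Even a.val
    · calc ∑ x : Fin (2 * k) with Even x.val, guardWeight f x (Sum.inl a)
          ≤ ∑ x : Fin (2 * k) with Even x.val, (if a = x then 2 else 0) := by
            refine Finset.sum_le_sum fun x hx => ?_
            have hx := (Finset.mem_filter.1 hx).2
            have h1 : a ≠ x + 1 := by rintro rfl; exact (Fin.even_val_add_one x).1 ha hx
            have h2 : a ≠ x - 1 := by rintro rfl; exact (Fin.even_val_sub_one x).1 ha hx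
            simp [guardWeight, h1, h2]
        _ ≤ 2 := by rw [Finset.sum_ite_eq]; split_ifs <;> simp
    · calc ∑ x : Fin (2 * k) with Even x.val, guardWeight f x (Sum.inl a)
          ≤ ∑ x : Fin (2 * k) with Even x.val,
              ((if a - 1 = x then 1 else 0) + (if a + 1 = x then 1 else 0)) := by
            refine Finset.sum_le_sum fun x hx => ?_
            have hx := (Finset.mem_filter.1 hx).2
            have h1 : a ≠ x := by rintro rfl; exact ha hx
            have h2 : a - 1 = x ↔ a = x + 1 := sub_eq_iff_eq_add
            have h3 : a + 1 = x ↔ a = x - 1 := eq_sub_iff_add_eq.symm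
            simp only [guardWeight, h1, h2, h3, if_false]
            split_ifs <;> simp_all
        _ ≤ 2 := by
            rw [Finset.sum_add_distrib, Finset.sum_ite_eq, Finset.sum_ite_eq]
            split_ifs <;> simp
  · simp only [guardWeight]
    rw [Finset.sum_ite_eq]
    split_ifs <;> simp

theorem one_le_guardWeight_of_adj_or_eq {x : Fin (2 * k)} {v w : Fin (2 * k) ⊕ P} (hk : 2 ≤ k)
    (hvw : w = v ∨ (cycleWithPendents (2 * k) f).Adj v w) (hw : guardWeight f x w = 2) :
    1 ≤ guardWeight f x v := by
  rcases hvw with rfl | hvw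
  · omega
  rcases w with b | q
  · have hb : b = x := by
      by_contra h
      simp only [guardWeight, h, if_false] at hw
      split_ifs at hw
      omega
    subst hb
    rcases v with a | p
    · have := (cycleWithPendents_adj_inl_inl hk f b a).1 hvw.symm
      simp only [guardWeight, this, if_true]
      split_ifs <;> simp
    · have : f p = b := hvw
      simp [guardWeight, this]
  · have hq : f q = x := by
      by_contra h
      simp [guardWeight, h] at hw
    rcases v with a | p
    · have : f q = a := hvw
      simp [guardWeight, ← this, hq]
    · exact hvw.elim

section Defense

variable {n : ℕ} {σ : List (cycleWithPendents (2 * k) f).edgeSet → Fin n → Fin (2 * k) ⊕ P}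

theorem guardWeight_add_le_sum (c : Fin n → Fin (2 * k) ⊕ P) (x : Fin (2 * k)) {i j : Fin n}
    (hij : i ≠ j) :
    guardWeight f x (c i) + guardWeight f x (c j) ≤ ∑ i, guardWeight f x (c i) := by
  rw [← Finset.sum_pair (f := fun i => guardWeight f x (c i)) hij]
  exact Finset.sum_le_sum_of_subset (Finset.subset_univ _)

theorem IsDefenseStrategy.exists_guardWeight_eq_two
    (hσ : IsDefenseStrategy (cycleWithPendents (2 * k) f) σ)
    (h : List (cycleWithPendents (2 * k) f).edgeSet) {x : Fin (2 * k)} (hx : ∃ p, f p = x) :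
    ∃ i, guardWeight f x (σ h i) = 2 := by
  obtain ⟨p, rfl⟩ := hx
  obtain ⟨i, hi | hi⟩ := hσ.exists_guard_of_adj h
    (show (cycleWithPendents (2 * k) f).Adj (Sum.inl (f p)) (Sum.inr p) from rfl)
  all_goals exact ⟨i, by rw [hi]; simp [guardWeight]⟩

/-- The pendent edge needs a guard of weight 2. Were it alone near `x`, attacking the edge from `x`
to `x + 1` would draw it off to `x + 1`, and no other guard could reach `x` or its pendents in time.
-/
theorem IsDefenseStrategy.three_le_sum_guardWeight
    (hσ : IsDefenseStrategy (cycleWithPendents (2 * k) f) σ) (hk : 2 ≤ k)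
    (h : List (cycleWithPendents (2 * k) f).edgeSet) {x : Fin (2 * k)} (hx : ∃ p, f p = x) :
    3 ≤ ∑ i, guardWeight f x (σ h i) := by
  have hadj : (cycleWithPendents (2 * k) f).Adj (Sum.inl x) (Sum.inl (x + 1)) :=
    (cycleWithPendents_adj_inl_inl hk f _ _).2 (Or.inl rfl)
  have hne : x + 1 ≠ x := by
    intro h
    have := Fin.even_val_add_one x
    rw [h] at this
    tauto
  have hw1 : 1 ≤ guardWeight f x (Sum.inl (x + 1)) := by simp [guardWeight, hne]
  obtain ⟨i, hi⟩ := hσ.exists_guardWeight_eq_two h hx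
  suffices H : ∃ j, j ≠ i ∧ 1 ≤ guardWeight f x (σ h j) by
    obtain ⟨j, hji, hj⟩ := H
    have := guardWeight_add_le_sum (f := f) (σ h) x hji
    omega
  by_contra! H
  obtain ⟨hmove, i', hi'⟩ := hσ h ⟨s(Sum.inl x, Sum.inl (x + 1)), hadj⟩
  have hi'1 : 1 ≤ guardWeight f x (σ h i') := by
    rcases Sym2.eq_iff.1 hi' with ⟨h1, -⟩ | ⟨h1, -⟩ <;> rw [h1]
    · simp [guardWeight]
    · exact hw1
  have hii' : i' = i := by
    by_contra hne'
    have := H i' hne'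
    omega
  subst hii'
  have hnext : guardWeight f x (σ (⟨s(Sum.inl x, Sum.inl (x + 1)), hadj⟩ :: h) i') ≠ 2 := by
    rcases Sym2.eq_iff.1 hi' with ⟨-, h1⟩ | ⟨h1, -⟩
    · rw [h1]; simp [guardWeight, hne]
    · rw [h1] at hi; simp [guardWeight, hne] at hi
  obtain ⟨j, hj⟩ := hσ.exists_guardWeight_eq_two (⟨s(Sum.inl x, Sum.inl (x + 1)), hadj⟩ :: h) hx
  have hji : j ≠ i' := by rintro rfl; exact hnext hj
  have := one_le_guardWeight_of_adj_or_eq hk (hmove j) hj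
  have := H j hji
  omega

/-- Besides the guard on the pendent, the two cycle edges at `f p` must be covered: by a guard on `f
p` (2 + 2) or by guards on both cycle neighbours (2 + 1 + 1). -/
theorem IsDefenseStrategy.four_le_sum_guardWeight
    (hσ : IsDefenseStrategy (cycleWithPendents (2 * k) f) σ) (hk : 2 ≤ k)
    (h : List (cycleWithPendents (2 * k) f).edgeSet) {p : P} {i : Fin n}
    (hi : σ h i = Sum.inr p) : 4 ≤ ∑ i, guardWeight f (f p) (σ h i) := by
  have hadj := cycleWithPendents_adj_inl_inl hk f (f p)
  have hi2 : guardWeight f (f p) (σ h i) = 2 := by rw [hi]; simp [guardWeight]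
  have center : ∀ j, σ h j = Sum.inl (f p) → 4 ≤ ∑ i, guardWeight f (f p) (σ h i) := by
    intro j hj
    have hij : i ≠ j := by rintro rfl; rw [hi] at hj; cases hj
    have := guardWeight_add_le_sum (f := f) (σ h) (f p) hij
    have : guardWeight f (f p) (σ h j) = 2 := by rw [hj]; simp [guardWeight]
    omega
  obtain ⟨j, hj | hj⟩ := hσ.exists_guard_of_adj h ((hadj _).2 (Or.inl rfl))
  · exact center j hj
  obtain ⟨l, hl | hl⟩ := hσ.exists_guard_of_adj h ((hadj _).2 (Or.inr rfl))
  · exact center l hl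
  have hij : i ≠ j := by rintro rfl; rw [hi] at hj; cases hj
  have hil : i ≠ l := by rintro rfl; rw [hi] at hl; cases hl
  have hjl : j ≠ l := by
    rintro rfl
    rw [hj] at hl
    have h2 := Sum.inl_injective hl
    rw [eq_sub_iff_add_eq, add_assoc, add_eq_left] at h2
    refine Fin.two_mul_nsmul_one_ne_zero (k := k) 1 one_pos (by omega) ?_
    rw [mul_one, two_nsmul]
    exact h2
  have hj1 : 1 ≤ guardWeight f (f p) (σ h j) := by
    rw [hj]; simp only [guardWeight]; split_ifs <;> simp_all
  have hl1 : 1 ≤ guardWeight f (f p) (σ h l) := by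
    rw [hl]; simp only [guardWeight]; split_ifs <;> simp_all
  have hsub := Finset.sum_le_sum_of_subset (f := fun i => guardWeight f (f p) (σ h i))
    (Finset.subset_univ {i, j, l})
  rw [Finset.sum_insert (by simp [hij, hil]), Finset.sum_pair hjl] at hsub
  omega

/-- Every defense strategy uses more than `3 * k / 2` guards. -/
theorem IsDefenseStrategy.three_mul_lt
    (hσ : IsDefenseStrategy (cycleWithPendents (2 * k) f) σ) (hk : 2 ≤ k)
    (hf : ∀ a : Fin (2 * k), Even a.val → ∃ p, f p = a) (p : P) (hp : Even (f p).val) :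
    3 * k < 2 * n := by
  have upper : ∀ h, ∑ x : Fin (2 * k) with Even x.val, ∑ i, guardWeight f x (σ h i) ≤ 2 * n := by
    intro h
    rw [Finset.sum_comm]
    calc _ ≤ ∑ _i : Fin n, 2 := Finset.sum_le_sum fun i _ => sum_guardWeight_le f (σ h i)
      _ = 2 * n := by simp [mul_comm]
  have card : (Finset.univ.filter fun x : Fin (2 * k) => Even x.val).card = k := by
    rw [← Set.ncard_coe_finset]
    simpa using Fin.ncard_even k
  -- A guard crossing the attacked pendent edge is on `p` either before or after the round.
  obtain ⟨h, i, hi⟩ : ∃ h i, σ h i = Sum.inr p := by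
    have hadj : (cycleWithPendents (2 * k) f).Adj (Sum.inl (f p)) (Sum.inr p) := rfl
    obtain ⟨-, i, hi⟩ := hσ [] ⟨s(Sum.inl (f p), Sum.inr p), hadj⟩
    rcases Sym2.eq_iff.1 hi with ⟨-, h1⟩ | ⟨h1, -⟩
    · exact ⟨_, i, h1⟩
    · exact ⟨_, i, h1⟩
  refine lt_of_lt_of_le ?_ (upper h)
  calc 3 * k = ∑ x : Fin (2 * k) with Even x.val, 3 := by simp [card, mul_comm]
    _ < _ := Finset.sum_lt_sum
      (fun x hx => hσ.three_le_sum_guardWeight hk h (hf x (Finset.mem_filter.1 hx).2))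
      ⟨f p, by simpa using hp, hσ.four_le_sum_guardWeight hk h hi⟩

end Defense

end

/-! ### Connectivity, cut vertices and cycles of the graph -/

section

variable {k : ℕ} [NeZero (2 * k)] {P : Type*} {f : P → Fin (2 * k)}

theorem Fin.add_val_nsmul_one {N : ℕ} [NeZero N] (z a : Fin N) : z + (a - z).val • 1 = a := by
  rw [← eq_sub_iff_add_eq', Fin.ext_iff, Fin.val_nsmul_one, Nat.mod_eq_of_lt (a - z).isLt]

/-- Walking forward from `z` reaches each remaining cycle vertex, and pendents hang on these. This
covers both the whole graph and the graph with one vertex deleted, where `z` follows a deleted cycle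
vertex. -/
theorem cycleWithPendents_induce_preconnected (hk : 2 ≤ k) (s : Set (Fin (2 * k) ⊕ P))
    (hs : ∀ p, Sum.inl (f p) ∈ s) (z : Fin (2 * k))
    (hz : ∀ a, Sum.inl a ∈ s → ∀ m ≤ (a - z).val, Sum.inl (z + m • 1) ∈ s) :
    ((cycleWithPendents (2 * k) f).induce s).Preconnected := by
  have walk : ∀ (m : ℕ) (hm : ∀ m' ≤ m, Sum.inl (z + m' • 1) ∈ s),
      ((cycleWithPendents (2 * k) f).induce s).Reachable
        ⟨Sum.inl (z + 0 • 1), hm 0 (Nat.zero_le _)⟩ ⟨Sum.inl (z + m • 1), hm m le_rfl⟩ := by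
    intro m
    induction m with
    | zero => intro hm; rfl
    | succ m ih =>
      intro hm
      refine (ih fun m' h => hm m' (by omega)).trans (SimpleGraph.Adj.reachable ?_)
      refine (cycleWithPendents_adj_inl_inl hk f _ _).2 (Or.inl ?_)
      rw [succ_nsmul, add_assoc]
  have inl_reach : ∀ a (ha : Sum.inl a ∈ s), ∃ hz0 : Sum.inl (z + 0 • 1) ∈ s,
      ((cycleWithPendents (2 * k) f).induce s).Reachable ⟨Sum.inl (z + 0 • 1), hz0⟩
        ⟨Sum.inl a, ha⟩ := by
    intro a ha
    refine ⟨hz a ha 0 (Nat.zero_le _), ?_⟩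
    convert walk _ (hz a ha) using 2
    rw [Fin.add_val_nsmul_one]
  have reach : ∀ v (hv : v ∈ s), ∃ hz0 : Sum.inl (z + 0 • 1) ∈ s,
      ((cycleWithPendents (2 * k) f).induce s).Reachable ⟨Sum.inl (z + 0 • 1), hz0⟩
        ⟨v, hv⟩ := by
    rintro (a | p) hv
    · exact inl_reach a hv
    · obtain ⟨hz0, h⟩ := inl_reach (f p) (hs p)
      exact ⟨hz0, h.trans (SimpleGraph.Adj.reachable (show f p = f p from rfl))⟩
  rintro ⟨u, hu⟩ ⟨v, hv⟩
  obtain ⟨_, h1⟩ := reach u hu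
  obtain ⟨_, h2⟩ := reach v hv
  exact h1.symm.trans h2

theorem cycleWithPendents_connected (hk : 2 ≤ k) (f : P → Fin (2 * k)) :
    (cycleWithPendents (2 * k) f).Connected := by
  rw [← (SimpleGraph.induceUnivIso _).connected_iff]
  have : Nonempty (Set.univ : Set (Fin (2 * k) ⊕ P)) := ⟨⟨Sum.inl 0, trivial⟩⟩
  exact ⟨cycleWithPendents_induce_preconnected hk _ (fun _ => trivial) 0 fun _ _ _ _ => trivial⟩

theorem cutVertices_cycleWithPendents_subset (hk : 2 ≤ k) (hfE : ∀ p, Even (f p).val) :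
    cutVertices (cycleWithPendents (2 * k) f) ⊆
      {v | ∃ a : Fin (2 * k), Even a.val ∧ Sum.inl a = v} := by
  rintro x ⟨u, v, hu, hv, -, hx⟩
  by_contra hxE
  have hs : ∀ p, (Sum.inl (f p) : Fin (2 * k) ⊕ P) ∈ ({x}ᶜ : Set (Fin (2 * k) ⊕ P)) :=
    fun p h => hxE ⟨f p, hfE p, h⟩
  apply hx
  rcases x with w | q
  · refine cycleWithPendents_induce_preconnected hk _ hs (w + 1) (fun a ha m hm h => ?_) _ _
    have h1 : w + 1 + m • 1 = w := Sum.inl_injective h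
    rw [add_assoc, add_eq_left, add_comm, ← succ_nsmul] at h1
    have h2 := congrArg Fin.val h1
    rw [Fin.val_nsmul_one] at h2
    -- The path from `w + 1` meets `w` only at its step `2 * k - 1`, the last possible one, which
    -- would force `a = w`.
    have h3 : (a - (w + 1)).val = m := by
      have := (a - (w + 1)).isLt
      have h4 : 2 * k ∣ m + 1 := Nat.dvd_of_mod_eq_zero (by simpa using h2)
      have := Nat.le_of_dvd (by omega) h4
      omega
    apply ha
    have h5 := Fin.add_val_nsmul_one (w + 1) a
    rw [h3, add_assoc, add_comm 1, ← succ_nsmul, h1, add_zero] at h5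
    rw [h5]; rfl
  · exact cycleWithPendents_induce_preconnected hk _ hs 0 (fun a ha m hm h => by cases h) _ _

/-- Vertices of a simple cycle have degree 2 in it. This excludes pendents and makes each cycle
vertex bring in both neighbours, so there is only one possible subgraph and the cactus condition is
vacuous. -/
theorem IsCycle.toSubgraph_cycleWithPendents (hk : 2 ≤ k) {u : Fin (2 * k) ⊕ P}
    {c : (cycleWithPendents (2 * k) f).Walk u u} (hc : c.IsCycle) :
    (∀ v, v ∈ c.toSubgraph.verts ↔ ∃ a, v = Sum.inl a) ∧
    ∀ v w, c.toSubgraph.Adj v w ↔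
      ∃ a, v = Sum.inl a ∧ (w = Sum.inl (a + 1) ∨ w = Sum.inl (a - 1)) := by
  have two : ∀ v ∈ c.toSubgraph.verts, (c.toSubgraph.neighborSet v).ncard = 2 := fun v hv =>
    hc.ncard_neighborSet_toSubgraph_eq_two ((SimpleGraph.Walk.mem_verts_toSubgraph c).1 hv)
  have no_pendent : ∀ p, Sum.inr p ∉ c.toSubgraph.verts := by
    intro p hp
    have hsub : c.toSubgraph.neighborSet (Sum.inr p) ⊆ {Sum.inl (f p)} := by
      rintro (a | q) h
      · have : f p = a := c.toSubgraph.adj_sub h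
        rw [this]; rfl
      · exact (c.toSubgraph.adj_sub h).elim
    have := Set.ncard_le_ncard hsub
    rw [two _ hp, Set.ncard_singleton] at this
    omega
  have nbr : ∀ a, Sum.inl a ∈ c.toSubgraph.verts →
      c.toSubgraph.neighborSet (Sum.inl a) = {Sum.inl (a + 1), Sum.inl (a - 1)} := by
    intro a ha
    refine Set.eq_of_subset_of_ncard_le ?_ ?_
    · rintro (b | q) h
      · rcases (cycleWithPendents_adj_inl_inl hk f a b).1 (c.toSubgraph.adj_sub h) with rfl | rfl
        · exact Or.inl rfl
        · exact Or.inr rfl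
      · exact absurd (c.toSubgraph.edge_vert h.symm) (no_pendent q)
    · rw [two _ ha]
      exact (Set.ncard_insert_le _ _).trans (by rw [Set.ncard_singleton])
  have nbr' : ∀ a w, Sum.inl a ∈ c.toSubgraph.verts →
      (c.toSubgraph.Adj (Sum.inl a) w ↔ w = Sum.inl (a + 1) ∨ w = Sum.inl (a - 1)) := by
    intro a w ha
    have := Set.ext_iff.1 (nbr a ha) w
    simpa using this
  have all : ∀ a, Sum.inl a ∈ c.toSubgraph.verts := by
    obtain ⟨z, hz⟩ : ∃ z, Sum.inl z ∈ c.toSubgraph.verts := by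
      have hu : u ∈ c.toSubgraph.verts := c.start_mem_verts_toSubgraph
      rcases u with z | p
      · exact ⟨z, hu⟩
      · exact absurd hu (no_pendent p)
    have : ∀ m : ℕ, Sum.inl (z + m • 1) ∈ c.toSubgraph.verts := by
      intro m
      induction m with
      | zero => simpa using hz
      | succ m ih =>
        have h := (nbr' _ _ ih).2 (Or.inl rfl)
        rw [succ_nsmul, ← add_assoc]
        exact c.toSubgraph.edge_vert h.symm
    intro a
    rw [← Fin.add_val_nsmul_one z a]
    exact this _
  refine ⟨?_, ?_⟩
  · rintro (a | p)
    · exact iff_of_true (all a) ⟨a, rfl⟩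
    · exact iff_of_false (no_pendent p) (by rintro ⟨a, h⟩; cases h)
  · rintro (a | p) w
    · rw [nbr' a w (all a)]
      constructor
      · exact fun h => ⟨a, rfl, h⟩
      · rintro ⟨b, hb, h⟩; cases hb; exact h
    · refine iff_of_false (fun h => no_pendent p (c.toSubgraph.edge_vert h)) ?_
      rintro ⟨b, hb, -⟩; cases hb

theorem isCactus_cycleWithPendents (hk : 2 ≤ k) (f : P → Fin (2 * k)) :
    IsCactus (cycleWithPendents (2 * k) f) := by
  refine ⟨cycleWithPendents_connected hk f, fun u v c d hc hd hne => absurd ?_ hne⟩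
  obtain ⟨hc1, hc2⟩ := IsCycle.toSubgraph_cycleWithPendents hk hc
  obtain ⟨hd1, hd2⟩ := IsCycle.toSubgraph_cycleWithPendents hk hd
  refine SimpleGraph.Subgraph.ext ?_ ?_
  · ext v; rw [hc1, hd1]
  · ext v w; rw [hc2, hd2]

end

/-! ### Vertex covers and the final count -/

/-- Collapsing pendents onto their cycle vertices, the image of a cover contains every even vertex,
since each has a pendent edge to cover. -/
theorem le_card_of_isVertexCover_cycleWithPendents {k : ℕ} {P : Type*} {f : P → Fin (2 * k)}
    (hf : ∀ a : Fin (2 * k), Even a.val → ∃ p, f p = a) (D : Finset (Fin (2 * k) ⊕ P))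
    (hD : (cycleWithPendents (2 * k) f).IsVertexCover (D : Set (Fin (2 * k) ⊕ P))) :
    k ≤ D.card := by
  have hex : ∀ a : Fin (2 * k), Even a.val → ∃ v ∈ D, Sum.elim id f v = a := by
    intro a ha
    obtain ⟨p, rfl⟩ := hf a ha
    rcases hD (show (cycleWithPendents (2 * k) f).Adj (Sum.inl (f p)) (Sum.inr p) from rfl)
      with h | h
    · exact ⟨_, h, rfl⟩
    · exact ⟨_, h, rfl⟩
  calc k = {a : Fin (2 * k) | Even a.val}.ncard := (Fin.ncard_even k).symm
    _ ≤ (Sum.elim id f '' (D : Set (Fin (2 * k) ⊕ P))).ncard :=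
      Set.ncard_le_ncard (fun a ha => hex a ha) (D.finite_toSet.image _)
    _ ≤ (D : Set (Fin (2 * k) ⊕ P)).ncard := Set.ncard_image_le D.finite_toSet
    _ = D.card := Set.ncard_coe_finset D

theorem ceil_add_one_div_two (k : ℕ) : ⌈((k : ℝ) + 1) / 2⌉₊ = k / 2 + 1 := by
  rw [Nat.ceil_eq_iff (by omega)]
  have h1 : ((k / 2 : ℕ) : ℝ) * 2 ≤ k := by exact_mod_cast Nat.div_mul_le_self k 2
  have h2 : (k : ℝ) ≤ ((k / 2 : ℕ) : ℝ) * 2 + 1 := by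
    exact_mod_cast (show k ≤ k / 2 * 2 + 1 by omega)
  push_cast
  constructor
  · linarith
  · linarith

theorem mainTheorem11 (k : ℕ) (hk : 2 ≤ k) {P : Type*} [Finite P] (f : P → Fin (2 * k))
    (hf : ∀ a : Fin (2 * k), (∃ p, f p = a) ↔ Even a.val) :
    IsCactus (cycleWithPendents (2 * k) f) ∧
    (∃ C : Finset (Fin (2 * k) ⊕ P),
      (cycleWithPendents (2 * k) f).IsVertexCover (C : Set (Fin (2 * k) ⊕ P)) ∧
      C.card = k ∧
      (∀ D : Finset (Fin (2 * k) ⊕ P),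
        (cycleWithPendents (2 * k) f).IsVertexCover (D : Set (Fin (2 * k) ⊕ P)) →
          C.card ≤ D.card) ∧
      cutVertices (cycleWithPendents (2 * k) f) ⊆ (C : Set (Fin (2 * k) ⊕ P))) ∧
    mvcX (cycleWithPendents (2 * k) f) = k ∧
    evc (cycleWithPendents (2 * k) f) = k + ⌈((k : ℝ) + 1) / 2⌉₊ ∧
    evcSingle (cycleWithPendents (2 * k) f) = k + ⌈((k : ℝ) + 1) / 2⌉₊ ∧
    (3 / 2 : ℝ) * (mvcX (cycleWithPendents (2 * k) f) : ℝ) <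
      (evc (cycleWithPendents (2 * k) f) : ℝ) ∧
    (3 / 2 : ℝ) * (mvcX (cycleWithPendents (2 * k) f) : ℝ) <
      (evcSingle (cycleWithPendents (2 * k) f) : ℝ) := by
  classical
  have : NeZero (2 * k) := ⟨by omega⟩
  have hfE : ∀ p, Even (f p).val := fun p => (hf _).1 ⟨p, rfl⟩
  have hf' : ∀ a : Fin (2 * k), Even a.val → ∃ p, f p = a := fun a => (hf a).2
  obtain ⟨C, hCcover, hCcard, hCcut⟩ : ∃ C : Finset (Fin (2 * k) ⊕ P),
      (cycleWithPendents (2 * k) f).IsVertexCover (C : Set (Fin (2 * k) ⊕ P)) ∧ C.card = k ∧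
      cutVertices (cycleWithPendents (2 * k) f) ⊆ (C : Set (Fin (2 * k) ⊕ P)) := by
    have hC : ∀ v : Fin (2 * k) ⊕ P,
        v ∈ (Finset.univ.filter fun a : Fin (2 * k) => Even a.val).image Sum.inl ↔
          ∃ a : Fin (2 * k), Even a.val ∧ Sum.inl a = v := by
      intro v; simp
    refine ⟨(Finset.univ.filter fun a : Fin (2 * k) => Even a.val).image Sum.inl, ?_, ?_, ?_⟩
    · intro u v huv
      simp only [Finset.mem_coe, hC]
      rcases u with a | p <;> rcases v with b | q
      · by_cases ha : Even a.val
        · exact Or.inl ⟨a, ha, rfl⟩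
        · rcases (cycleWithPendents_adj_inl_inl hk f a b).1 huv with rfl | rfl
          · exact Or.inr ⟨_, (Fin.even_val_add_one a).2 ha, rfl⟩
          · exact Or.inr ⟨_, (Fin.even_val_sub_one a).2 ha, rfl⟩
      · have h : f q = a := huv
        exact Or.inl ⟨a, h ▸ hfE q, rfl⟩
      · have h : f p = b := huv
        exact Or.inr ⟨b, h ▸ hfE p, rfl⟩
      · exact huv.elim
    · rw [Finset.card_image_of_injective _ Sum.inl_injective, ← Set.ncard_coe_finset]
      simpa using Fin.ncard_even k
    · intro v hv
      exact (hC v).2 (cutVertices_cycleWithPendents_subset hk hfE hv)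
  have hmin := le_card_of_isVertexCover_cycleWithPendents hf'
  have hmvc : mvcX (cycleWithPendents (2 * k) f) = k := by
    refine le_antisymm (Nat.sInf_le ⟨C, hCcover, hCcut, hCcard⟩) ?_
    refine le_csInf ⟨k, C, hCcover, hCcut, hCcard⟩ ?_
    rintro n ⟨D, hD, -, rfl⟩
    exact hmin D hD
  obtain ⟨c, hc, hcS⟩ := exists_robust_configuration hk f
  obtain ⟨σ, hσ, hσinj⟩ := exists_injective_strategy hk hfE (by omega) c hc hcS
  have lower : ∀ n, (∃ σ : List (cycleWithPendents (2 * k) f).edgeSet → Fin n → Fin (2 * k) ⊕ P,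
      IsDefenseStrategy (cycleWithPendents (2 * k) f) σ) → k + (k / 2 + 1) ≤ n := by
    rintro n ⟨τ, hτ⟩
    obtain ⟨p, -⟩ := hf' 0 (by simp)
    have := hτ.three_mul_lt hk hf' p (hfE p)
    omega
  -- The strategy `σ` also shows that the set is nonempty, so `sInf` is not the default value 0.
  have hevc : evc (cycleWithPendents (2 * k) f) = k + (k / 2 + 1) :=
    le_antisymm (Nat.sInf_le ⟨σ, hσ⟩) (le_csInf ⟨_, σ, hσ⟩ fun n hn => lower n hn)
  have hevcS : evcSingle (cycleWithPendents (2 * k) f) = k + (k / 2 + 1) :=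
    le_antisymm (Nat.sInf_le ⟨σ, hσ, hσinj⟩) (le_csInf ⟨_, σ, hσ, hσinj⟩
      fun n ⟨τ, hτ, _⟩ => lower n ⟨τ, hτ⟩)
  have hlt : (3 / 2 : ℝ) * (k : ℝ) < ((k + (k / 2 + 1) : ℕ) : ℝ) := by
    have : ((3 * k : ℕ) : ℝ) < ((2 * (k + (k / 2 + 1)) : ℕ) : ℝ) := by
      exact_mod_cast (show 3 * k < 2 * (k + (k / 2 + 1)) by omega)
    rw [Nat.cast_mul, Nat.cast_mul] at this
    norm_num at this ⊢
    linarith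
  refine ⟨isCactus_cycleWithPendents hk f, ⟨C, hCcover, hCcard, fun D hD => hCcard.trans_le (hmin D hD),
    hCcut⟩, hmvc, ?_, ?_, ?_, ?_⟩
  · rw [hevc, ceil_add_one_div_two]
  · rw [hevcS, ceil_add_one_div_two]
  · rw [hmvc, hevc]; exact hlt
  · rw [hmvc, hevcS]; exact hlt
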